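/- Let $\Delta\subset\mathbb R^2$ be the Sierpiński triangle obtained from a closed equilateral triangle of side length one: $\Delta=\bigcap_{n\ge 0}\Delta_n$, where $\Delta_0$ is the closed triangle and $\Delta_{n+1}$ is the union of the images of $\Delta_n$ under the three homotheties of ratio $1/2$ centred at the vertices of $\Delta_0$. For $0<\alpha<1$ let $C_1^\alpha(\Delta)$ be the set of all functions $f:\Delta\to\mathbb R$ with $|f(x)-f(y)|\le |x-y|^\alpha$ for all $x,y\in\Delta$, equipped with the metric of the supremum norm. For $f\in C_1^\alpha(\Delta)$ put $$D_*^f(\Delta)=\sup\bigl\{d\ge 0:\ \lambda\{r\in\mathbb R:\ \dim_H f^{-1}(r)\ge d\}>0\bigr\},$$ where $\lambda$ is the Lebesgue measure on $\mathbb R$ and $\dim_H$ is the Hausdorff dimension (with $\dim_H\emptyset=0$), and let $$D_*(\alpha,\Delta)=\sup_{\mathcal G}\ \inf_{f\in\mathcal G} D_*^f(\Delta),$$ where the supremum is over all dense $G_\delta$ subsets $\mathcal G$ of $C_1^\alpha(\Delta)$. Then, for every $0<\alpha<1$, $$D_*(\alpha,\Delta)\le 1-2^{-\alpha}.$$ 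-/

import Mathlib

open Set MeasureTheory
open scoped ENNReal BoundedContinuousFunction

noncomputable section

/-- The vertices `(0,0)`, `(1,0)`, `(1/2, √3/2)` of an equilateral triangle of side length one. -/
def sierpinskiVertex : Fin 3 → EuclideanSpace ℝ (Fin 2) :=
  ![!₂[0, 0], !₂[1, 0], !₂[1 / 2, Real.sqrt 3 / 2]]

/-- The `n`-th stage `Δ_n` of the construction of the Sierpiński triangle: `Δ_0` is the closed
(filled) equilateral triangle, and `Δ_{n+1}` is the union of the images of `Δ_n` under the three
homotheties of ratio `1/2` centred at the vertices. Thus `Δ_n` is the union of the `3 ^ n` closed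
triangles of side length `2 ^ (-n)` that are left after `n` steps. -/
def sierpinskiStage : ℕ → Set (EuclideanSpace ℝ (Fin 2))
  | 0 => convexHull ℝ (range sierpinskiVertex)
  | n + 1 => ⋃ i : Fin 3,
      AffineMap.homothety (sierpinskiVertex i) (1 / 2 : ℝ) '' sierpinskiStage n

/-- The Sierpiński triangle `Δ = ⋂ n, Δ_n`. -/
def sierpinskiTriangle : Set (EuclideanSpace ℝ (Fin 2)) :=
  ⋂ n, sierpinskiStage n

/-- The set `C_c^α(F)` of `c`-Hölder-`α` functions on a bounded set `F ⊆ ℝ^p`, as a subset of the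
bounded continuous functions on `F`, hence with the metric of the supremum norm.
(For `α > 0` and bounded `F`, every `c`-Hölder-`α` function is bounded and continuous.) -/
def holderClass {p : ℕ} (c α : ℝ) (F : Set (EuclideanSpace ℝ (Fin p))) : Set (F →ᵇ ℝ) :=
  {f | ∀ x y : F, |f x - f y| ≤ c * dist x y ^ α}

/-- `D^f(r, F)`, the Hausdorff dimension of the level set `f⁻¹(r)`. -/
def levelDim {p : ℕ} {F : Set (EuclideanSpace ℝ (Fin p))} (f : F → ℝ) (r : ℝ) : ℝ≥0∞ :=
  dimH (((↑) : F → EuclideanSpace ℝ (Fin p)) '' (f ⁻¹' {r}))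

/-- `D_*^f(F) = sup {d : λ {r : D^f(r, F) ≥ d} > 0}`, with `λ` the Lebesgue measure on `ℝ`. -/
def essLevelDim {p : ℕ} {F : Set (EuclideanSpace ℝ (Fin p))} (f : F → ℝ) : ℝ≥0∞ :=
  sSup {d : ℝ≥0∞ | 0 < volume {r : ℝ | d ≤ levelDim f r}}

/-- `D_*(α, F)`: the supremum, over all dense `G_δ` subsets `𝒢` of the space `C_1^α(F)`, of
`inf {D_*^f(F) : f ∈ 𝒢}`. -/
def genericLevelDim {p : ℕ} (α : ℝ) (F : Set (EuclideanSpace ℝ (Fin p))) : ℝ≥0∞ :=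
  ⨆ (G : Set (holderClass 1 α F)) (_ : IsGδ G ∧ Dense G),
    ⨅ f ∈ G, essLevelDim (f : F →ᵇ ℝ)

end

/-! Put `q = 2^(-α)` and `p = 1 - q`. The heart is a self-similar height function on the triangle:
it is `0` on one side, `1` at the opposite vertex, and it takes the value `p` at the midpoints of
the other two sides. The apex cell carries the values `[p, 1]` as a copy scaled by `q`; the two base
cells both carry `[0, p]` as copies scaled by `p ≤ q`. Hence the oscillation on cells of level `n`
is at most `q^n = 2^(-αn)`, which is exactly `α`-Hölder behaviour. A level chosen uniformly in `[0,
1]` falls in the doubled range with probability `p`, independently at each scale, so it typically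
meets about `2^(pn)` cells of level `n`, which suggests dimension `p`.

This is made quantitative by moments instead of a law of large numbers. The `t`-th moment of the
cell count is multiplied by `2^t p + q` at each step (`CellMomentLE.glue_apex`,
`exists_height_function`). For `s > p` and small `t > 0` this factor is below `2^(st)`
(`exists_moment_exponent`), so Markov's inequality bounds the measure of the levels meeting many
cells (`exists_approx_cellCount`).

Such functions are dense: shrink a given function slightly, make it Lipschitz, and interpolate on
small cells by rescaled height functions (`exists_approx_cellMomentLE`). Counting cells for a
thickened range makes the estimate stable under small perturbations, hence an open condition. By
Baire, every dense `G_δ` contains a function satisfying it along levels tending to infinity.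
Borel–Cantelli and `dimH_le_of_covers` bound almost every level set of that function by dimension
`s`. -/

/-! ### Barycentric coordinates and self-similarity of the triangle -/

/-- The homothety of ratio `1/2` centred at the `i`-th vertex. -/
noncomputable def sierpinskiMap (i : Fin 3) (x : EuclideanSpace ℝ (Fin 2)) :
    EuclideanSpace ℝ (Fin 2) :=
  AffineMap.homothety (sierpinskiVertex i) (1 / 2 : ℝ) x

/-- Barycentric coordinates with respect to the vertices of the Sierpiński triangle. -/
noncomputable def bary (m : Fin 3) (x : EuclideanSpace ℝ (Fin 2)) : ℝ :=
  ![1 - x 0 - x 1 / Real.sqrt 3, x 0 - x 1 / Real.sqrt 3, 2 * (x 1 / Real.sqrt 3)] m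

lemma sierpinskiMap_apply (i : Fin 3) (x : EuclideanSpace ℝ (Fin 2)) (k : Fin 2) :
    sierpinskiMap i x k = (sierpinskiVertex i k + x k) / 2 := by
  simp [sierpinskiMap, AffineMap.homothety_apply]
  ring

lemma bary_vertex (m i : Fin 3) : bary m (sierpinskiVertex i) = if m = i then 1 else 0 := by
  have h3 : Real.sqrt 3 ≠ 0 := by positivity
  fin_cases m <;> fin_cases i <;> simp [bary, sierpinskiVertex] <;> field_simp <;> norm_num

lemma bary_sierpinskiMap (m i : Fin 3) (x : EuclideanSpace ℝ (Fin 2)) :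
    bary m (sierpinskiMap i x) = ((if m = i then 1 else 0) + bary m x) / 2 := by
  rw [← bary_vertex]
  fin_cases m <;> simp [bary, sierpinskiMap_apply] <;> ring

lemma sum_bary (x : EuclideanSpace ℝ (Fin 2)) : bary 0 x + bary 1 x + bary 2 x = 1 := by
  simp [bary]; ring

lemma ext_bary {x y : EuclideanSpace ℝ (Fin 2)} (h : ∀ m, bary m x = bary m y) : x = y := by
  have h3 : Real.sqrt 3 ≠ 0 := by positivity
  have h1 := h 1
  have h2 := h 2
  simp only [bary, Matrix.cons_val] at h1 h2
  have h4 : x 1 / Real.sqrt 3 = y 1 / Real.sqrt 3 := by linarith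
  ext k
  fin_cases k
  · simp; linarith
  · simp; field_simp at h4; exact h4

lemma abs_bary_sub_le (m : Fin 3) (x y : EuclideanSpace ℝ (Fin 2)) :
    |bary m x - bary m y| ≤ 2 * dist x y := by
  have hk : ∀ k, |x k - y k| ≤ dist x y := fun k => by
    rw [dist_eq_norm]; simpa using PiLp.norm_apply_le (x - y) k
  have h3 : 1 ≤ Real.sqrt 3 := by rw [Real.one_le_sqrt]; norm_num
  have h4 : |x 1 / Real.sqrt 3 - y 1 / Real.sqrt 3| ≤ dist x y := by
    rw [← sub_div, abs_div, abs_of_pos (a := Real.sqrt 3) (by positivity)]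
    exact (div_le_self (abs_nonneg _) h3).trans (hk 1)
  have h0 := hk 0
  rw [abs_le] at *
  fin_cases m <;> simp [bary] <;> constructor <;> linarith

lemma dist_sierpinskiMap (i : Fin 3) (x y : EuclideanSpace ℝ (Fin 2)) :
    dist (sierpinskiMap i x) (sierpinskiMap i y) = dist x y / 2 := by
  have : sierpinskiMap i x - sierpinskiMap i y = (1 / 2 : ℝ) • (x - y) := by
    ext k; simp [sierpinskiMap_apply]; ring
  rw [dist_eq_norm, this, norm_smul, dist_eq_norm]; norm_num; ring

lemma sierpinskiMap_injective (i : Fin 3) : Function.Injective (sierpinskiMap i) := by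
  intro x y h
  have := dist_sierpinskiMap i x y
  rw [h, dist_self] at this
  exact dist_eq_zero.1 (by linarith)

lemma sierpinskiMap_vertex (i : Fin 3) :
    sierpinskiMap i (sierpinskiVertex i) = sierpinskiVertex i := by
  ext k; simp [sierpinskiMap_apply]

lemma sierpinskiMap_vertex_comm (i j : Fin 3) :
    sierpinskiMap i (sierpinskiVertex j) = sierpinskiMap j (sierpinskiVertex i) := by
  ext k; simp [sierpinskiMap_apply, add_comm]

lemma mem_sierpinskiStage_succ {n : ℕ} {x : EuclideanSpace ℝ (Fin 2)} :
    x ∈ sierpinskiStage (n + 1) ↔ ∃ i, ∃ y ∈ sierpinskiStage n, sierpinskiMap i y = x := by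
  simp [sierpinskiStage, sierpinskiMap]

lemma sierpinskiStage_antitone : Antitone sierpinskiStage := by
  refine antitone_nat_of_succ_le fun n => ?_
  induction n with
  | zero =>
    intro x hx
    obtain ⟨i, y, hy, rfl⟩ := mem_sierpinskiStage_succ.1 hx
    have hv : sierpinskiVertex i ∈ sierpinskiStage 0 :=
      subset_convexHull ℝ _ (mem_range_self i)
    have := (convex_convexHull ℝ (range sierpinskiVertex)) hv hy
      (by norm_num : (0 : ℝ) ≤ 1 / 2) (by norm_num : (0 : ℝ) ≤ 1 / 2) (by norm_num)
    have hxy : sierpinskiMap i y = (1 / 2 : ℝ) • sierpinskiVertex i + (1 / 2 : ℝ) • y := by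
      ext k; simp [sierpinskiMap_apply]; ring
    rwa [hxy]
  | succ n ih =>
    intro x hx
    obtain ⟨i, y, hy, rfl⟩ := mem_sierpinskiStage_succ.1 hx
    exact mem_sierpinskiStage_succ.2 ⟨i, y, ih hy, rfl⟩

lemma sierpinskiVertex_mem (i : Fin 3) : sierpinskiVertex i ∈ sierpinskiTriangle := by
  refine mem_iInter.2 fun n => ?_
  induction n with
  | zero => exact subset_convexHull ℝ _ (mem_range_self i)
  | succ n ih => exact mem_sierpinskiStage_succ.2 ⟨i, _, ih, sierpinskiMap_vertex i⟩

lemma sierpinskiMap_mem (i : Fin 3) {x : EuclideanSpace ℝ (Fin 2)}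
    (hx : x ∈ sierpinskiTriangle) : sierpinskiMap i x ∈ sierpinskiTriangle := by
  refine mem_iInter.2 fun n => sierpinskiStage_antitone n.le_succ ?_
  exact mem_sierpinskiStage_succ.2 ⟨i, x, mem_iInter.1 hx n, rfl⟩

/-- If no first-level cell contained `x`, each homothety would fail to reach `x` from some stage on,
and the largest of the three stages contradicts membership of `x` in the next one. Injectivity makes
the preimages from different stages the same point. -/
lemma exists_sierpinskiMap_eq {x : EuclideanSpace ℝ (Fin 2)} (hx : x ∈ sierpinskiTriangle) :
    ∃ i, ∃ y ∈ sierpinskiTriangle, sierpinskiMap i y = x := by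
  by_contra! h
  have key : ∀ i, ∃ n, ∀ m, n ≤ m → ∀ y ∈ sierpinskiStage m, sierpinskiMap i y ≠ x := by
    intro i
    by_contra! h'
    obtain ⟨-, -, y, -, hy⟩ := h' 0
    refine h i y (mem_iInter.2 fun n => ?_) hy
    obtain ⟨m, hnm, z, hz, hzx⟩ := h' n
    rw [sierpinskiMap_injective i (hy.trans hzx.symm)]
    exact sierpinskiStage_antitone hnm hz
  choose n hn using key
  obtain ⟨i, y, hy, hyx⟩ :=
    mem_sierpinskiStage_succ.1 (mem_iInter.1 hx (Finset.univ.sup n + 1))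
  exact hn i _ (Finset.le_sup (Finset.mem_univ i)) y hy hyx

lemma bary_nonneg (m : Fin 3) {x : EuclideanSpace ℝ (Fin 2)} (hx : x ∈ sierpinskiTriangle) :
    0 ≤ bary m x := by
  have hconv : Convex ℝ {x | 0 ≤ bary m x} := by
    intro x hx y hy a b ha hb hab
    have : bary m (a • x + b • y) = a * bary m x + b * bary m y := by
      fin_cases m
      · simp [bary]; linear_combination (-1 : ℝ) * hab
      · simp [bary]; ring
      · simp [bary]; ring
    simp only [mem_ofPred_eq] at *
    rw [this]; positivity
  have : convexHull ℝ (range sierpinskiVertex) ⊆ {x | 0 ≤ bary m x} := by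
    refine convexHull_min ?_ hconv
    rintro _ ⟨i, rfl⟩
    simp only [mem_ofPred_eq, bary_vertex]
    split_ifs <;> norm_num
  exact this (mem_iInter.1 hx 0)

lemma bary_le_one (m : Fin 3) {x : EuclideanSpace ℝ (Fin 2)} (hx : x ∈ sierpinskiTriangle) :
    bary m x ≤ 1 := by
  have h0 := bary_nonneg 0 hx
  have h1 := bary_nonneg 1 hx
  have h2 := bary_nonneg 2 hx
  have := sum_bary x
  fin_cases m <;> simp <;> linarith

lemma eq_vertex_of_one_le_bary {m : Fin 3} {x : EuclideanSpace ℝ (Fin 2)}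
    (hx : x ∈ sierpinskiTriangle) (h : 1 ≤ bary m x) : x = sierpinskiVertex m := by
  have h0 := bary_nonneg 0 hx
  have h1 := bary_nonneg 1 hx
  have h2 := bary_nonneg 2 hx
  have := sum_bary x
  refine ext_bary fun k => ?_
  rw [bary_vertex]
  fin_cases m <;> fin_cases k <;> simp at h ⊢ <;> linarith

/-- The `j`-th barycentric coordinate is at most `1/2` on cell `i` and at least `1/2` on cell `j`,
so a common point has it equal to `1/2`. -/
lemma eq_vertex_of_sierpinskiMap_eq {i j : Fin 3} (hij : i ≠ j) {x y : EuclideanSpace ℝ (Fin 2)}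
    (hx : x ∈ sierpinskiTriangle) (hy : y ∈ sierpinskiTriangle)
    (h : sierpinskiMap i x = sierpinskiMap j y) : x = sierpinskiVertex j := by
  refine eq_vertex_of_one_le_bary hx ?_
  have := congrArg (bary j) h
  simp only [bary_sierpinskiMap, hij.symm, if_true, if_false] at this
  linarith [bary_nonneg j hy]

lemma dist_le_two {x y : EuclideanSpace ℝ (Fin 2)} (hx : x ∈ sierpinskiTriangle)
    (hy : y ∈ sierpinskiTriangle) : dist x y ≤ 2 := by
  have key : convexHull ℝ (range sierpinskiVertex) ⊆ Metric.closedBall 0 1 := by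
    refine convexHull_min ?_ (convex_closedBall _ _)
    rintro _ ⟨i, rfl⟩
    rw [mem_closedBall_zero_iff, EuclideanSpace.norm_eq, Real.sqrt_le_one]
    fin_cases i <;> norm_num [sierpinskiVertex, div_pow]
  have h1 := key (mem_iInter.1 hx 0)
  have h2 := key (mem_iInter.1 hy 0)
  rw [Metric.mem_closedBall] at h1 h2
  linarith [dist_triangle_right x y 0]

/-- A function on the Sierpiński triangle can be prescribed on the three cells of the first level
if the prescriptions agree at the three common points. -/
lemma exists_glue (h : Fin 3 → EuclideanSpace ℝ (Fin 2) → ℝ)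
    (hc : ∀ i j, h i (sierpinskiVertex j) = h j (sierpinskiVertex i)) :
    ∃ g : EuclideanSpace ℝ (Fin 2) → ℝ,
      ∀ i, ∀ x ∈ sierpinskiTriangle, g (sierpinskiMap i x) = h i x := by
  have key : ∀ z, ∃ c, ∀ i, ∀ x ∈ sierpinskiTriangle, sierpinskiMap i x = z → h i x = c := by
    intro z
    by_cases hz : ∃ i, ∃ x ∈ sierpinskiTriangle, sierpinskiMap i x = z
    · obtain ⟨i, x, hx, rfl⟩ := hz
      refine ⟨h i x, fun j y hy hyx => ?_⟩
      by_cases hij : i = j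
      · subst hij; rw [sierpinskiMap_injective i hyx]
      · rw [eq_vertex_of_sierpinskiMap_eq (Ne.symm hij) hy hx hyx,
          eq_vertex_of_sierpinskiMap_eq hij hx hy hyx.symm, hc]
    · push Not at hz
      exact ⟨0, fun i x hx hxz => absurd hxz (hz i x hx)⟩
  choose g hg using key
  exact ⟨g, fun i x hx => (hg _ i x hx rfl).symm⟩

/-! ### Cells of level `n` and their lattice positions -/

/-- The composition of the homotheties listed in a word. -/
noncomputable def wordMap : List (Fin 3) → EuclideanSpace ℝ (Fin 2) → EuclideanSpace ℝ (Fin 2)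
  | [], x => x
  | i :: w, x => sierpinskiMap i (wordMap w x)

/-- The position of a cell in the triangular lattice. -/
def wordIndex (m : Fin 3) : List (Fin 3) → ℤ
  | [] => 0
  | i :: w => (if m = i then 2 ^ w.length else 0) + wordIndex m w

lemma wordMap_mem (w : List (Fin 3)) {x : EuclideanSpace ℝ (Fin 2)}
    (hx : x ∈ sierpinskiTriangle) : wordMap w x ∈ sierpinskiTriangle := by
  induction w with
  | nil => exact hx
  | cons i w ih => exact sierpinskiMap_mem i ih

lemma exists_wordMap_eq (n : ℕ) {x : EuclideanSpace ℝ (Fin 2)} (hx : x ∈ sierpinskiTriangle) :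
    ∃ w : List (Fin 3), w.length = n ∧ ∃ y ∈ sierpinskiTriangle, wordMap w y = x := by
  induction n generalizing x with
  | zero => exact ⟨[], rfl, x, hx, rfl⟩
  | succ n ih =>
    obtain ⟨i, y, hy, rfl⟩ := exists_sierpinskiMap_eq hx
    obtain ⟨w, hw, z, hz, rfl⟩ := ih hy
    exact ⟨i :: w, by simp [hw], z, hz, rfl⟩

lemma dist_wordMap (w : List (Fin 3)) (x y : EuclideanSpace ℝ (Fin 2)) :
    dist (wordMap w x) (wordMap w y) = dist x y / 2 ^ w.length := by
  induction w with
  | nil => simp [wordMap]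
  | cons i w ih => rw [wordMap, wordMap, dist_sierpinskiMap, ih, List.length_cons, pow_succ]; ring

/-- In barycentric coordinates magnified by `2 ^ w.length`, a cell is the original triangle
translated by an integer vector; adjacency of cells becomes a question about integers. -/
lemma two_pow_mul_bary_wordMap (m : Fin 3) (w : List (Fin 3)) (x : EuclideanSpace ℝ (Fin 2)) :
    2 ^ w.length * bary m (wordMap w x) = wordIndex m w + bary m x := by
  induction w with
  | nil => simp [wordMap, wordIndex]
  | cons i w ih =>
    rw [wordMap, bary_sierpinskiMap, wordIndex, List.length_cons, pow_succ]
    push_cast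
    split_ifs <;> linear_combination ih

lemma sum_wordIndex (w : List (Fin 3)) :
    wordIndex 0 w + wordIndex 1 w + wordIndex 2 w = 2 ^ w.length - 1 := by
  induction w with
  | nil => simp [wordIndex]
  | cons i w ih =>
    simp only [wordIndex, List.length_cons, pow_succ]
    fin_cases i <;> simp <;> linarith

/-- Cells of the same level that are close to each other have a common point. -/
lemma exists_wordMap_eq_wordMap {w w' : List (Fin 3)} (hw : w.length = w'.length)
    {x y : EuclideanSpace ℝ (Fin 2)} (hx : x ∈ sierpinskiTriangle) (hy : y ∈ sierpinskiTriangle)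
    (h : dist (wordMap w x) (wordMap w' y) < 1 / (2 * 2 ^ w.length)) :
    ∃ i j, wordMap w (sierpinskiVertex i) = wordMap w' (sierpinskiVertex j) := by
  -- The magnified coordinates of the two points differ by less than `1` and the local coordinates
  -- lie in `[0, 1]`, so the integer positions differ by less than `2`.
  have hd : ∀ m, |wordIndex m w - wordIndex m w'| ≤ 1 := by
    intro m
    have h1 := two_pow_mul_bary_wordMap m w x
    have h2 := two_pow_mul_bary_wordMap m w' y
    have h3 := abs_bary_sub_le m (wordMap w x) (wordMap w' y)
    rw [← hw] at h2
    have h4 : |2 ^ w.length * bary m (wordMap w x) - 2 ^ w.length * bary m (wordMap w' y)| < 1 := by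
      rw [← mul_sub, abs_mul, abs_of_pos (by positivity : (0 : ℝ) < 2 ^ w.length)]
      rw [lt_div_iff₀ (by positivity)] at h
      calc _ ≤ 2 ^ w.length * (2 * dist (wordMap w x) (wordMap w' y)) := by gcongr
        _ < 1 := by linarith
    rw [h1, h2, abs_lt] at h4
    have b1 := bary_nonneg m hx
    have b2 := bary_le_one m hx
    have b3 := bary_nonneg m hy
    have b4 := bary_le_one m hy
    have : |wordIndex m w - wordIndex m w'| < 2 := by
      rw [abs_lt]
      constructor <;> rify <;> linarith
    omega
  have hs := sum_wordIndex w
  have hs' := sum_wordIndex w'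
  rw [← hw] at hs'
  have key : ∀ i j, (∀ m, wordIndex m w + (if m = i then 1 else 0)
      = wordIndex m w' + (if m = j then 1 else 0)) →
      wordMap w (sierpinskiVertex i) = wordMap w' (sierpinskiVertex j) := by
    intro i j hij
    refine ext_bary fun m => ?_
    have h1 := two_pow_mul_bary_wordMap m w (sierpinskiVertex i)
    have h2 := two_pow_mul_bary_wordMap m w' (sierpinskiVertex j)
    rw [← hw] at h2
    rw [bary_vertex] at h1 h2
    have h3 := hij m
    refine mul_left_cancel₀ (by positivity : (2 : ℝ) ^ w.length ≠ 0) ?_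
    rw [h1, h2]
    exact_mod_cast h3
  suffices ∃ i j, ∀ m, wordIndex m w + (if m = i then 1 else 0)
      = wordIndex m w' + (if m = j then 1 else 0) by
    obtain ⟨i, j, hij⟩ := this
    exact ⟨i, j, key i j hij⟩
  have h0 := abs_le.1 (hd 0)
  have h1 := abs_le.1 (hd 1)
  have h2 := abs_le.1 (hd 2)
  -- Both positions have the same coordinate sum, so the difference is zero or one of the six
  -- differences of two unit vectors; in each case the cells share a vertex.
  have : (wordIndex 0 w - wordIndex 0 w' = 0 ∧ wordIndex 1 w - wordIndex 1 w' = 0) ∨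
      (wordIndex 0 w - wordIndex 0 w' = 0 ∧ wordIndex 1 w - wordIndex 1 w' = 1) ∨
      (wordIndex 0 w - wordIndex 0 w' = 0 ∧ wordIndex 1 w - wordIndex 1 w' = -1) ∨
      (wordIndex 0 w - wordIndex 0 w' = 1 ∧ wordIndex 1 w - wordIndex 1 w' = 0) ∨
      (wordIndex 0 w - wordIndex 0 w' = 1 ∧ wordIndex 1 w - wordIndex 1 w' = -1) ∨
      (wordIndex 0 w - wordIndex 0 w' = -1 ∧ wordIndex 1 w - wordIndex 1 w' = 0) ∨
      (wordIndex 0 w - wordIndex 0 w' = -1 ∧ wordIndex 1 w - wordIndex 1 w' = 1) := by omega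
  rcases this with h | h | h | h | h | h | h
  · refine ⟨0, 0, fun m => ?_⟩; fin_cases m <;> simp <;> omega
  · refine ⟨2, 1, fun m => ?_⟩; fin_cases m <;> simp <;> omega
  · refine ⟨1, 2, fun m => ?_⟩; fin_cases m <;> simp <;> omega
  · refine ⟨2, 0, fun m => ?_⟩; fin_cases m <;> simp <;> omega
  · refine ⟨1, 0, fun m => ?_⟩; fin_cases m <;> simp <;> omega
  · refine ⟨0, 2, fun m => ?_⟩; fin_cases m <;> simp <;> omega
  · refine ⟨0, 1, fun m => ?_⟩; fin_cases m <;> simp <;> omega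

/-! ### Counting the cells that meet a level set -/

/-- The number of cells of level `n` of the Sierpiński triangle on which `h` takes values
at distance less than `δ` from `r`. -/
noncomputable def cellCount : ℕ → (EuclideanSpace ℝ (Fin 2) → ℝ) → ℝ → ℝ → ℝ≥0∞
  | 0, h, δ, r => (Metric.thickening δ (h '' sierpinskiTriangle)).indicator 1 r
  | n + 1, h, δ, r => ∑ i, cellCount n (h ∘ sierpinskiMap i) δ r

lemma measurable_cellCount (n : ℕ) (h : EuclideanSpace ℝ (Fin 2) → ℝ) (δ : ℝ) :
    Measurable (cellCount n h δ) := by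
  induction n generalizing h with
  | zero => exact measurable_one.indicator Metric.isOpen_thickening.measurableSet
  | succ n ih => exact Finset.measurable_sum _ fun i _ => ih _

lemma cellCount_congr (n : ℕ) {g h : EuclideanSpace ℝ (Fin 2) → ℝ}
    (hgh : EqOn g h sierpinskiTriangle) (δ r : ℝ) : cellCount n g δ r = cellCount n h δ r := by
  induction n generalizing g h with
  | zero => rw [cellCount, cellCount, hgh.image_eq]
  | succ n ih =>
    exact Finset.sum_congr rfl fun i _ => ih fun x hx => hgh (sierpinskiMap_mem i hx)

lemma cellCount_le (n : ℕ) (h : EuclideanSpace ℝ (Fin 2) → ℝ) (δ r : ℝ) :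
    cellCount n h δ r ≤
      3 ^ n * (Metric.thickening δ (h '' sierpinskiTriangle)).indicator 1 r := by
  induction n generalizing h with
  | zero => simp [cellCount]
  | succ n ih =>
    calc cellCount (n + 1) h δ r
        ≤ ∑ _i : Fin 3, 3 ^ n * (Metric.thickening δ (h '' sierpinskiTriangle)).indicator 1 r := by
          refine Finset.sum_le_sum fun i _ => (ih _).trans ?_
          gcongr 3 ^ n * ?_
          refine indicator_le_indicator_of_subset (Metric.thickening_subset_of_subset δ ?_)
            (fun _ => zero_le) r
          rw [image_comp]
          exact image_mono (image_subset_iff.2 fun x hx => sierpinskiMap_mem i hx)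
      _ = _ := by simp [pow_succ]; ring

lemma cellCount_affine (n : ℕ) (h : EuclideanSpace ℝ (Fin 2) → ℝ) (a : ℝ) {b : ℝ} (hb : b ≠ 0)
    (δ r : ℝ) :
    cellCount n (fun x => a + b * h x) δ (a + b * r) = cellCount n h (δ / |b|) r := by
  induction n generalizing h with
  | zero =>
    have : a + b * r ∈ Metric.thickening δ ((fun x => a + b * h x) '' sierpinskiTriangle) ↔
        r ∈ Metric.thickening (δ / |b|) (h '' sierpinskiTriangle) := by
      simp only [Metric.mem_thickening_iff, exists_mem_image, Real.dist_eq]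
      refine exists_congr fun x => and_congr_right fun _ => ?_
      rw [add_sub_add_left_eq_sub, ← mul_sub, abs_mul, lt_div_iff₀' (abs_pos.2 hb)]
    by_cases hr : r ∈ Metric.thickening (δ / |b|) (h '' sierpinskiTriangle)
    · rw [cellCount, cellCount, indicator_of_mem hr, indicator_of_mem (this.2 hr)]; rfl
    · rw [cellCount, cellCount, indicator_of_notMem hr, indicator_of_notMem (mt this.1 hr)]
  | succ n ih => exact Finset.sum_congr rfl fun i _ => ih _

/-- If `f` is `δ`-close to `h`, then the level sets of `f` are covered by the cells counted by
`cellCount`. -/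
lemma exists_cover_level (n : ℕ) {f h : EuclideanSpace ℝ (Fin 2) → ℝ} {δ : ℝ}
    (hf : ∀ x ∈ sierpinskiTriangle, |f x - h x| < δ) (r : ℝ) :
    ∃ F : Finset (Set (EuclideanSpace ℝ (Fin 2))), (F.card : ℝ≥0∞) ≤ cellCount n h δ r ∧
      (∀ s ∈ F, ∀ x ∈ s, ∀ y ∈ s, dist x y ≤ 2 / 2 ^ n) ∧
      {x ∈ sierpinskiTriangle | f x = r} ⊆ ⋃ s ∈ F, s := by
  classical
  induction n generalizing f h with
  | zero =>
    by_cases hr : ∃ x ∈ sierpinskiTriangle, f x = r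
    · obtain ⟨x, hx, rfl⟩ := hr
      refine ⟨{sierpinskiTriangle}, ?_, ?_, ?_⟩
      · rw [cellCount, indicator_of_mem]
        · simp
        · exact Metric.mem_thickening_iff.2 ⟨h x, mem_image_of_mem h hx, hf x hx⟩
      · simpa using fun x hx y hy => dist_le_two hx hy
      · simp
    · push Not at hr
      exact ⟨∅, by simp, by simp, fun x hx => absurd hx.2 (hr x hx.1)⟩
  | succ n ih =>
    choose F hF1 hF2 hF3 using fun i => ih (f := f ∘ sierpinskiMap i) (h := h ∘ sierpinskiMap i)
      fun x hx => hf _ (sierpinskiMap_mem i hx)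
    refine ⟨Finset.univ.biUnion fun i => (F i).image fun s => sierpinskiMap i '' s, ?_, ?_, ?_⟩
    · calc _ ≤ ((∑ i, (F i).card : ℕ) : ℝ≥0∞) := by
            gcongr
            exact Finset.card_biUnion_le.trans
              (Finset.sum_le_sum fun i _ => Finset.card_image_le)
        _ ≤ _ := by
            rw [Nat.cast_sum]
            exact Finset.sum_le_sum fun i _ => hF1 i
    · simp only [Finset.mem_biUnion, Finset.mem_image, Finset.mem_univ, true_and]
      rintro _ ⟨i, s, hs, rfl⟩ _ ⟨x, hx, rfl⟩ _ ⟨y, hy, rfl⟩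
      rw [dist_sierpinskiMap, pow_succ, ← div_div]
      gcongr
      exact hF2 i s hs x hx y hy
    · rintro x ⟨hx, hxr⟩
      obtain ⟨i, y, hy, rfl⟩ := exists_sierpinskiMap_eq hx
      obtain ⟨s, hs, hys⟩ := mem_iUnion₂.1 (hF3 i ⟨hy, hxr⟩)
      refine mem_iUnion₂.2 ⟨sierpinskiMap i '' s, ?_, mem_image_of_mem _ hys⟩
      simp only [Finset.mem_biUnion, Finset.mem_image, Finset.mem_univ, true_and]
      exact ⟨i, s, hs, rfl⟩

/-! ### Moments of the cell count -/

/-- The `t`-th moment of the number of cells meeting a level set is at most `Q`, up to an error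
that is linear in the thickening. -/
def CellMomentLE (t : ℝ) (n : ℕ) (h : EuclideanSpace ℝ (Fin 2) → ℝ) (Q : ℝ≥0∞) : Prop :=
  ∃ C : ℝ≥0∞, C ≠ ∞ ∧ ∀ δ > 0, ∫⁻ r, cellCount n h δ r ^ t ≤ Q + C * ENNReal.ofReal δ

lemma CellMomentLE.congr {t : ℝ} {n : ℕ} {g h : EuclideanSpace ℝ (Fin 2) → ℝ} {Q : ℝ≥0∞}
    (hh : CellMomentLE t n h Q) (hgh : EqOn g h sierpinskiTriangle) : CellMomentLE t n g Q := by
  simpa only [CellMomentLE, cellCount_congr n hgh] using hh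

lemma CellMomentLE.mono {t : ℝ} {n : ℕ} {h : EuclideanSpace ℝ (Fin 2) → ℝ} {Q Q' : ℝ≥0∞}
    (hh : CellMomentLE t n h Q) (hQ : Q ≤ Q') : CellMomentLE t n h Q' := by
  obtain ⟨C, hC, H⟩ := hh
  exact ⟨C, hC, fun δ hδ => (H δ hδ).trans (by gcongr)⟩

lemma cellMomentLE_bary {t : ℝ} (ht : 0 < t) (j : Fin 3) : CellMomentLE t 0 (bary j) 1 := by
  refine ⟨2, by simp, fun δ hδ => ?_⟩
  have hsub : Metric.thickening δ (bary j '' sierpinskiTriangle) ⊆ Ioo (-δ) (1 + δ) := by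
    intro r hr
    obtain ⟨_, ⟨x, hx, rfl⟩, hxr⟩ := Metric.mem_thickening_iff.1 hr
    rw [Real.dist_eq, abs_lt] at hxr
    have h1 := bary_nonneg j hx
    have h2 := bary_le_one j hx
    constructor <;> linarith
  calc ∫⁻ r, cellCount 0 (bary j) δ r ^ t
      ≤ ∫⁻ r, (Ioo (-δ) (1 + δ)).indicator 1 r := by
        refine lintegral_mono fun r => ?_
        by_cases hr : r ∈ Metric.thickening δ (bary j '' sierpinskiTriangle)
        · rw [cellCount, indicator_of_mem hr, indicator_of_mem (hsub hr)]; simp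
        · rw [cellCount, indicator_of_notMem hr, ENNReal.zero_rpow_of_pos ht]; exact zero_le
    _ = 1 + 2 * ENNReal.ofReal δ := by
        rw [lintegral_indicator_one measurableSet_Ioo, Real.volume_Ioo,
          show 1 + δ - -δ = 1 + 2 * δ by ring, ENNReal.ofReal_add zero_le_one (by positivity),
          ENNReal.ofReal_mul zero_le_two]
        simp

lemma lintegral_eq_affine (f : ℝ → ℝ≥0∞) (a : ℝ) {b : ℝ} (hb : b ≠ 0) :
    ∫⁻ r, f r = ENNReal.ofReal |b| * ∫⁻ r, f (a + b * r) := by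
  rw [← lintegral_add_left_eq_self f a]
  nth_rw 1 [← Real.smul_map_volume_mul_left hb]
  rw [lintegral_smul_measure, smul_eq_mul]
  congr 1
  exact lintegral_map_equiv (fun r => f (a + r)) (MeasurableEquiv.mulLeft₀ b hb)

/-- For `b ≠ 0` this is a change of variables; the factor `|b|` cancels against the rescaled
thickening `δ / |b|`, so the same error constant serves. For `b = 0` only levels in an interval of
length `2δ` count, and the whole moment goes into the error term. -/
lemma CellMomentLE.affine {t : ℝ} (ht : 0 < t) {n : ℕ} {h : EuclideanSpace ℝ (Fin 2) → ℝ}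
    {Q : ℝ≥0∞} (hh : CellMomentLE t n h Q) (a b : ℝ) :
    CellMomentLE t n (fun x => a + b * h x) (ENNReal.ofReal |b| * Q) := by
  obtain rfl | hb := eq_or_ne b 0
  · refine ⟨(3 ^ n) ^ t * 2, by finiteness, fun δ hδ => ?_⟩
    calc ∫⁻ r, cellCount n (fun x => a + 0 * h x) δ r ^ t
        ≤ ∫⁻ r, (3 ^ n) ^ t * (Metric.ball a δ).indicator 1 r := by
          refine lintegral_mono fun r => ?_
          have := cellCount_le n (fun x => a + 0 * h x) δ r
          have himg : (fun x => a + 0 * h x) '' sierpinskiTriangle = {a} := by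
            simp only [zero_mul, add_zero]
            exact Nonempty.image_const ⟨_, sierpinskiVertex_mem 0⟩ a
          rw [himg, Metric.thickening_singleton] at this
          refine (ENNReal.rpow_le_rpow this ht.le).trans ?_
          rw [ENNReal.mul_rpow_of_nonneg _ _ ht.le]
          gcongr
          by_cases hr : r ∈ Metric.ball a δ
          · simp [indicator_of_mem hr]
          · simp [indicator_of_notMem hr, ht]
      _ = _ := by
          rw [lintegral_const_mul' _ _ (by finiteness),
            lintegral_indicator_one measurableSet_ball, Real.volume_ball,
            ENNReal.ofReal_mul zero_le_two]
          simp [mul_assoc]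
  · obtain ⟨C, hC, H⟩ := hh
    refine ⟨C, hC, fun δ hδ => ?_⟩
    have hb' := abs_pos.2 hb
    rw [lintegral_eq_affine _ a hb]
    simp only [cellCount_affine n h a hb]
    calc _ ≤ ENNReal.ofReal |b| * (Q + C * ENNReal.ofReal (δ / |b|)) := by
          gcongr; exact H _ (by positivity)
      _ = _ := by
          rw [mul_add, mul_left_comm, ← ENNReal.ofReal_mul hb'.le, mul_div_cancel₀ _ hb'.ne']

/-- Subadditivity of `x ↦ x ^ t` for `t ≤ 1`. The factor `3` is wasteful, but this lemma is applied
only at the coarse levels, whose number stays fixed. -/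
lemma CellMomentLE.glue {t : ℝ} (ht : 0 < t) (ht1 : t ≤ 1) {n : ℕ}
    {g : EuclideanSpace ℝ (Fin 2) → ℝ} {h : Fin 3 → EuclideanSpace ℝ (Fin 2) → ℝ} {Q : ℝ≥0∞}
    (hh : ∀ i, CellMomentLE t n (h i) Q)
    (hg : ∀ i, ∀ x ∈ sierpinskiTriangle, g (sierpinskiMap i x) = h i x) :
    CellMomentLE t (n + 1) g (3 * Q) := by
  choose C hC H using fun i => (hh i).congr (g := g ∘ sierpinskiMap i) (hg i)
  refine ⟨∑ i, C i, by simpa using hC, fun δ hδ => ?_⟩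
  have hm : ∀ i, Measurable fun r => cellCount n (g ∘ sierpinskiMap i) δ r ^ t :=
    fun i => (measurable_cellCount _ _ _).pow_const t
  calc ∫⁻ r, cellCount (n + 1) g δ r ^ t
      ≤ ∫⁻ r, ∑ i, cellCount n (g ∘ sierpinskiMap i) δ r ^ t := by
        refine lintegral_mono fun r => ?_
        rw [cellCount, Fin.sum_univ_three, Fin.sum_univ_three]
        refine (ENNReal.rpow_add_le_add_rpow _ _ ht.le ht1).trans ?_
        gcongr
        exact ENNReal.rpow_add_le_add_rpow _ _ ht.le ht1
    _ = ∑ i, ∫⁻ r, cellCount n (g ∘ sierpinskiMap i) δ r ^ t :=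
        lintegral_finsetSum _ fun i _ => hm i
    _ ≤ ∑ i, (Q + C i * ENNReal.ofReal δ) := Finset.sum_le_sum fun i _ => H i δ hδ
    _ = _ := by rw [Finset.sum_add_distrib, Finset.sum_mul]; simp

/-- The two base cells carry the same function, so their counts add up to exactly `2` times one
count, which costs `2 ^ t` in the moment rather than the `2` of plain subadditivity. This gain
produces the sharp growth factor. -/
lemma CellMomentLE.glue_apex {t : ℝ} (ht : 0 < t) (ht1 : t ≤ 1) {n : ℕ} (j : Fin 3)
    {g h h' : EuclideanSpace ℝ (Fin 2) → ℝ} {Q Q' : ℝ≥0∞}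
    (hh : CellMomentLE t n h Q) (hh' : CellMomentLE t n h' Q')
    (hg : ∀ i, ∀ x ∈ sierpinskiTriangle,
      g (sierpinskiMap i x) = if i = j then h' x else h x) :
    CellMomentLE t (n + 1) g (2 ^ t * Q + Q') := by
  obtain ⟨C, hC, H⟩ := hh
  obtain ⟨C', hC', H'⟩ := hh'
  refine ⟨2 ^ t * C + C', by finiteness, fun δ hδ => ?_⟩
  have hcount : ∀ r, cellCount (n + 1) g δ r = 2 * cellCount n h δ r + cellCount n h' δ r := by
    intro r
    have : ∀ i, cellCount n (g ∘ sierpinskiMap i) δ r =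
        if i = j then cellCount n h' δ r else cellCount n h δ r := by
      intro i
      split_ifs with hij
      · exact cellCount_congr n (fun x hx => by simpa [hij] using hg i x hx) δ r
      · exact cellCount_congr n (fun x hx => by simpa [hij] using hg i x hx) δ r
    rw [cellCount, Finset.sum_congr rfl fun i _ => this i, Fin.sum_univ_three]
    fin_cases j <;> simp <;> ring
  calc ∫⁻ r, cellCount (n + 1) g δ r ^ t
      ≤ ∫⁻ r, (2 ^ t * cellCount n h δ r ^ t + cellCount n h' δ r ^ t) := by
        refine lintegral_mono fun r => ?_
        rw [hcount, ← ENNReal.mul_rpow_of_nonneg _ _ ht.le]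
        exact ENNReal.rpow_add_le_add_rpow _ _ ht.le ht1
    _ = 2 ^ t * (∫⁻ r, cellCount n h δ r ^ t) + ∫⁻ r, cellCount n h' δ r ^ t := by
        rw [lintegral_add_right _ ((measurable_cellCount _ _ _).pow_const t),
          lintegral_const_mul' _ _ (by finiteness)]
    _ ≤ 2 ^ t * (Q + C * ENNReal.ofReal δ) + (Q' + C' * ENNReal.ofReal δ) := by
        gcongr
        · exact H δ hδ
        · exact H' δ hδ
    _ = _ := by ring

/-! ### Height functions and interpolation -/

/-- A function of the height over one side of the triangle, with values `0` on that side and `1` at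
the opposite vertex, whose level sets meet few cells of level `m`: the value of the function at the
midpoints of the two other sides is `p`. -/
lemma exists_height_function {p q t : ℝ} (hp : 0 ≤ p) (hpq : p ≤ q) (hadd : p + q = 1)
    (ht : 0 < t) (ht1 : t ≤ 1) (j : Fin 3) (m : ℕ) :
    ∃ φ : EuclideanSpace ℝ (Fin 2) → ℝ,
      (∀ i, φ (sierpinskiVertex i) = if i = j then 1 else 0) ∧
      (∀ x ∈ sierpinskiTriangle, φ x ∈ Icc 0 1) ∧
      (∀ w, ∀ x ∈ sierpinskiTriangle, ∀ y ∈ sierpinskiTriangle,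
        |φ (wordMap w x) - φ (wordMap w y)| ≤ q ^ w.length) ∧
      CellMomentLE t m φ ((2 ^ t * ENNReal.ofReal p + ENNReal.ofReal q) ^ m) := by
  have hq : 1 / 2 ≤ q := by linarith
  induction m with
  | zero =>
    refine ⟨bary j, fun i => ?_, fun x hx => ⟨bary_nonneg j hx, bary_le_one j hx⟩, ?_, ?_⟩
    · rw [bary_vertex]; simp only [eq_comm]
    · intro w x hx y hy
      have h1 := two_pow_mul_bary_wordMap j w x
      have h2 := two_pow_mul_bary_wordMap j w y
      have h3 : bary j (wordMap w x) - bary j (wordMap w y) =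
          (1 / 2) ^ w.length * (bary j x - bary j y) := by
        rw [one_div, inv_pow, eq_inv_mul_iff_mul_eq₀ (by positivity)]
        linear_combination h1 - h2
      rw [h3, abs_mul, abs_of_pos (by positivity)]
      have : |bary j x - bary j y| ≤ 1 := by
        rw [abs_le]
        constructor <;> linarith [bary_nonneg j hx, bary_nonneg j hy, bary_le_one j hx,
          bary_le_one j hy]
      calc _ ≤ (1 / 2 : ℝ) ^ w.length * 1 := by gcongr
        _ ≤ _ := by rw [mul_one]; gcongr
    · simpa using cellMomentLE_bary ht j
  | succ m ih =>
    obtain ⟨φ, hv, hr, hosc, hN⟩ := ih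
    -- The base copies scaled by `p` and the apex copy scaled by `q` meet at height `p`. Since `p ≤
    -- q`, each level contracts oscillation by at least the factor `q`, and the moment is multiplied
    -- by `2 ^ t * p + q`.
    obtain ⟨g, hg⟩ := exists_glue (fun i x => if i = j then p + q * φ x else 0 + p * φ x) (by
      intro i k
      simp only [hv]
      split_ifs <;> simp_all)
    have hrange : ∀ z ∈ sierpinskiTriangle, g z ∈ Icc 0 1 := by
      intro z hz
      obtain ⟨i, y, hy, rfl⟩ := exists_sierpinskiMap_eq hz
      rw [hg i y hy]
      obtain ⟨h0, h1⟩ := hr y hy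
      split_ifs <;> constructor <;> nlinarith
    refine ⟨g, fun i => ?_, fun x hx => ?_, fun w x hx y hy => ?_, ?_⟩
    · rw [← sierpinskiMap_vertex i, hg i _ (sierpinskiVertex_mem i), hv]
      split_ifs <;> simp [hadd]
    · exact hrange x hx
    · cases w with
      | nil =>
        have h1 := hrange x hx
        have h2 := hrange y hy
        simp only [wordMap, List.length_nil, pow_zero, abs_le]
        constructor <;> linarith [h1.1, h1.2, h2.1, h2.2]
      | cons i w =>
        rw [wordMap, wordMap, hg i _ (wordMap_mem w hx), hg i _ (wordMap_mem w hy),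
          List.length_cons, pow_succ']
        split_ifs
        · rw [add_sub_add_left_eq_sub, ← mul_sub, abs_mul, abs_of_pos (by linarith)]
          gcongr
          exact hosc w x hx y hy
        · rw [add_sub_add_left_eq_sub, ← mul_sub, abs_mul, abs_of_nonneg hp]
          gcongr
          exact hosc w x hx y hy
    · convert CellMomentLE.glue_apex ht ht1 j (hN.affine ht 0 p) (hN.affine ht p q) hg using 1
      rw [abs_of_nonneg hp, abs_of_nonneg (hp.trans hpq)]
      ring

/-- A height function takes only two values at the vertices, while three are prescribed. One
subdivision resolves this: giving the midpoint between vertices `i` and `i + 1` the value `a i`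
leaves only two values at the corners of each first-level cell. -/
lemma exists_interpolation_triangle {p q t : ℝ} (hp : 0 ≤ p) (hpq : p ≤ q) (hadd : p + q = 1)
    (ht : 0 < t) (ht1 : t ≤ 1) (m : ℕ) {a : Fin 3 → ℝ} {B : ℝ} (ha : ∀ i j, |a i - a j| ≤ B) :
    ∃ g : EuclideanSpace ℝ (Fin 2) → ℝ,
      (∀ i, g (sierpinskiVertex i) = a i) ∧
      (∀ x ∈ sierpinskiTriangle, ∀ i, |g x - a i| ≤ 2 * B) ∧
      (∀ n, ∀ w : List (Fin 3), w.length = n + 1 → ∀ x ∈ sierpinskiTriangle,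
        ∀ y ∈ sierpinskiTriangle, |g (wordMap w x) - g (wordMap w y)| ≤ B * q ^ n) ∧
      CellMomentLE t (m + 1) g (3 * (ENNReal.ofReal B *
        (2 ^ t * ENNReal.ofReal p + ENNReal.ofReal q) ^ m)) := by
  have hB : 0 ≤ B := (abs_nonneg _).trans (ha 0 0)
  choose φ hv hr hosc hN using fun j => exists_height_function hp hpq hadd ht ht1 j m
  -- On cell `i`, the corner towards vertex `i + 2` gets `a (i + 2)` and the other two corners get
  -- `a i`; indices are modulo `3`.
  obtain ⟨g, hg⟩ := exists_glue (fun i x => a i + (a (i + 2) - a i) * φ (i + 2) x) (by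
    intro i k
    simp only [hv]
    fin_cases i <;> fin_cases k <;> simp)
  refine ⟨g, fun i => ?_, fun x hx k => ?_, fun n w hw x hx y hy => ?_, ?_⟩
  · rw [← sierpinskiMap_vertex i, hg i _ (sierpinskiVertex_mem i), hv]
    fin_cases i <;> simp
  · obtain ⟨i, y, hy, rfl⟩ := exists_sierpinskiMap_eq hx
    rw [hg i y hy]
    obtain ⟨h0, h1⟩ := hr (i + 2) y hy
    have h2 : |(a (i + 2) - a i) * φ (i + 2) y| ≤ B * 1 := by
      rw [abs_mul, abs_of_nonneg h0]
      exact mul_le_mul (ha _ _) h1 h0 hB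
    have h3 := ha i k
    rw [abs_le] at *
    constructor <;> linarith
  · cases w with
    | nil => simp at hw
    | cons i w =>
      have hw' : w.length = n := by simpa using hw
      rw [wordMap, wordMap, hg i _ (wordMap_mem w hx), hg i _ (wordMap_mem w hy),
        add_sub_add_left_eq_sub, ← mul_sub, abs_mul]
      gcongr
      · exact ha _ _
      · exact hw' ▸ hosc _ w x hx y hy
  · refine CellMomentLE.glue ht ht1 (fun i => ?_) hg
    refine ((hN (i + 2)).affine ht _ _).mono ?_
    gcongr
    exact ha _ _

/-- Interpolation of `f` on the cells of level `N` by functions whose level sets meet few cells. -/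
lemma exists_interpolation {p q t : ℝ} (hp : 0 ≤ p) (hpq : p ≤ q) (hadd : p + q = 1)
    (ht : 0 < t) (ht1 : t ≤ 1) (m N : ℕ) {B : ℝ} {f : EuclideanSpace ℝ (Fin 2) → ℝ}
    (hf : ∀ w : List (Fin 3), w.length = N → ∀ x ∈ sierpinskiTriangle,
        ∀ y ∈ sierpinskiTriangle, |f (wordMap w x) - f (wordMap w y)| ≤ B) :
    ∃ g : EuclideanSpace ℝ (Fin 2) → ℝ,
      (∀ i, g (sierpinskiVertex i) = f (sierpinskiVertex i)) ∧
      (∀ x ∈ sierpinskiTriangle, |g x - f x| ≤ 3 * B) ∧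
      (∀ n, ∀ w : List (Fin 3), w.length = n + 1 + N → ∀ x ∈ sierpinskiTriangle,
        ∀ y ∈ sierpinskiTriangle, |g (wordMap w x) - g (wordMap w y)| ≤ B * q ^ n) ∧
      CellMomentLE t (m + 1 + N) g (3 ^ (N + 1) * (ENNReal.ofReal B *
        (2 ^ t * ENNReal.ofReal p + ENNReal.ofReal q) ^ m)) := by
  induction N generalizing f with
  | zero =>
    have hf0 : ∀ x ∈ sierpinskiTriangle, ∀ y ∈ sierpinskiTriangle, |f x - f y| ≤ B := hf [] rfl
    obtain ⟨g, hv, hr, hosc, hN⟩ := exists_interpolation_triangle hp hpq hadd ht ht1 m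
      (a := fun i => f (sierpinskiVertex i)) (B := B)
      fun i j => hf0 _ (sierpinskiVertex_mem i) _ (sierpinskiVertex_mem j)
    refine ⟨g, hv, fun x hx => ?_, hosc, by simpa using hN⟩
    have h1 := hr x hx 0
    have h2 := hf0 _ (sierpinskiVertex_mem 0) x hx
    rw [abs_le] at *
    constructor <;> linarith
  | succ N ih =>
    choose h hv hr hosc hN using fun i => ih (f := f ∘ sierpinskiMap i)
      fun w hw x hx y hy => hf (i :: w) (by simp [hw]) x hx y hy
    obtain ⟨g, hg⟩ := exists_glue h fun i j => by
      simp only [hv, Function.comp, sierpinskiMap_vertex_comm]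
    refine ⟨g, fun i => ?_, fun x hx => ?_, fun n w hw x hx y hy => ?_, ?_⟩
    · rw [← sierpinskiMap_vertex i, hg i _ (sierpinskiVertex_mem i), hv]; rfl
    · obtain ⟨i, y, hy, rfl⟩ := exists_sierpinskiMap_eq hx
      rw [hg i y hy]
      exact hr i y hy
    · cases w with
      | nil => simp at hw
      | cons i w =>
        rw [wordMap, wordMap, hg i _ (wordMap_mem w hx), hg i _ (wordMap_mem w hy)]
        exact hosc i n w (by simp at hw; omega) x hx y hy
    · have := CellMomentLE.glue ht ht1 hN hg
      rwa [← mul_assoc, ← pow_succ'] at this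

/-! ### Hölder estimates and Lipschitz regularization -/

/-- A function with oscillation at most `A * 2 ^ (-α n)` on the cells of level `n + n₀` is locally
Hölder continuous with exponent `α`. -/
lemma abs_sub_le_of_oscillation_le {α A : ℝ} (hα : 0 < α) {n₀ : ℕ}
    {g : EuclideanSpace ℝ (Fin 2) → ℝ}
    (hg : ∀ n, ∀ w : List (Fin 3), w.length = n + n₀ → ∀ x ∈ sierpinskiTriangle,
      ∀ y ∈ sierpinskiTriangle, |g (wordMap w x) - g (wordMap w y)| ≤ A * ((2 : ℝ) ^ (-α)) ^ n)
    {x y : EuclideanSpace ℝ (Fin 2)} (hx : x ∈ sierpinskiTriangle) (hy : y ∈ sierpinskiTriangle)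
    (hxy : 4 * 2 ^ n₀ * dist x y ≤ 1) :
    |g x - g y| ≤ 2 * A * (8 * 2 ^ n₀ * dist x y) ^ α := by
  obtain hd | hd := (dist_nonneg (x := x) (y := y)).eq_or_lt
  · rw [dist_eq_zero.1 hd.symm]; simp [hα.ne']
  -- The scale `n` is chosen so that the distance is comparable to the size of cells of level `n +
  -- n₀` and small enough that the cells of `x` and `y` share a vertex; two oscillations then bound
  -- the increment.
  obtain ⟨n, hn1, hn2⟩ := exists_nat_pow_near_of_lt_one (x := 4 * 2 ^ n₀ * dist x y)
    (y := (1 / 2 : ℝ)) (by positivity) hxy (by norm_num) (by norm_num)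
  obtain ⟨w, hw, x', hx', rfl⟩ := exists_wordMap_eq (n + n₀) hx
  obtain ⟨w', hw', y', hy', rfl⟩ := exists_wordMap_eq (n + n₀) hy
  obtain ⟨i, j, hij⟩ := exists_wordMap_eq_wordMap (hw.trans hw'.symm) hx' hy' (by
    rw [hw, lt_div_iff₀ (by positivity), pow_add]
    rw [one_div, inv_pow, ← one_div, le_div_iff₀ (by positivity)] at hn2
    linarith)
  have h1 := hg n w hw _ hx' _ (sierpinskiVertex_mem i)
  have h2 := hg n w' hw' _ hy' _ (sierpinskiVertex_mem j)
  have hA : 0 ≤ A := by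
    have := (abs_nonneg _).trans h1
    exact nonneg_of_mul_nonneg_left this (by positivity)
  rw [← hij] at h2
  have hpow : ((2 : ℝ) ^ (-α)) ^ n ≤ (8 * 2 ^ n₀ * dist (wordMap w x') (wordMap w' y')) ^ α := by
    calc ((2 : ℝ) ^ (-α)) ^ n = ((1 / 2 : ℝ) ^ n) ^ α := by
          rw [Real.rpow_neg two_pos.le, ← Real.inv_rpow two_pos.le, ← Real.rpow_natCast,
            ← Real.rpow_natCast, ← Real.rpow_mul (by norm_num), ← Real.rpow_mul (by norm_num),
            mul_comm, one_div]
      _ ≤ _ := by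
          refine Real.rpow_le_rpow (by positivity) ?_ hα.le
          rw [pow_succ] at hn1
          linarith
  calc |g (wordMap w x') - g (wordMap w' y')| ≤ 2 * A * ((2 : ℝ) ^ (-α)) ^ n := by
        rw [abs_le] at *
        constructor <;> linarith
    _ ≤ _ := by gcongr

/-- A bounded Hölder function on a subset of a metric space is uniformly approximated by Lipschitz
functions on the whole space that are Hölder with the same constant. -/
lemma exists_lipschitz_holder_approx {X : Type*} [PseudoMetricSpace X] {s : Set X}
    (hs : s.Nonempty) {α c τ : ℝ} (hα : 0 < α) (hα1 : α < 1) (hc : 0 ≤ c) (hτ : 0 < τ) {f : s → ℝ}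
    (hb : BddBelow (range f)) (hf : ∀ x y, |f x - f y| ≤ c * dist x y ^ α) :
    ∃ F : X → ℝ, (∀ x y, |F x - F y| ≤ c * dist x y ^ α) ∧
      (∀ x y, |F x - F y| ≤ c * τ ^ (α - 1) * dist x y) ∧
      ∀ x : s, |F x - f x| ≤ c * τ ^ α := by
  have : Nonempty s := hs.to_subtype
  -- The modulus `w d = d * ρ d` equals `d ^ α` beyond `τ` and is linear below it. It is subadditive
  -- because `ρ` is nonincreasing.
  set ρ : ℝ → ℝ := fun d => min (d ^ (α - 1)) (τ ^ (α - 1)) with hρ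
  have hρ0 : ∀ d, 0 ≤ d → 0 ≤ ρ d := fun d hd => by simp only [hρ]; positivity
  have hdpow : ∀ d : ℝ, 0 ≤ d → d * d ^ (α - 1) = d ^ α := fun d hd => by
    obtain rfl | hd := hd.eq_or_lt
    · simp [hα.ne']
    · rw [Real.rpow_sub_one hd.ne']; field_simp
  set w : ℝ → ℝ := fun d => d * ρ d with hw
  have hw' : ∀ d, 0 ≤ d → w d = min (d ^ α) (d * τ ^ (α - 1)) := fun d hd => by
    simp only [hw, hρ]
    rw [mul_min_of_nonneg _ _ hd, hdpow d hd]
  have hw0 : ∀ d, 0 ≤ d → 0 ≤ w d := fun d hd => mul_nonneg hd (hρ0 d hd)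
  have hmono : ∀ a b, 0 ≤ a → a ≤ b → w a ≤ w b := fun a b ha hab => by
    rw [hw' a ha, hw' b (ha.trans hab)]
    gcongr
  have hanti : ∀ a b, 0 < a → a ≤ b → ρ b ≤ ρ a := fun a b ha hab => by
    simp only [hρ]
    gcongr ?_ ⊓ _
    exact Real.rpow_le_rpow_of_nonpos ha hab (by linarith)
  have hsub : ∀ a b, 0 ≤ a → 0 ≤ b → w (a + b) ≤ w a + w b := by
    intro a b ha hb
    obtain rfl | ha := ha.eq_or_lt
    · simp [hw]
    obtain rfl | hb := hb.eq_or_lt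
    · simp [hw]
    calc w (a + b) = a * ρ (a + b) + b * ρ (a + b) := by simp only [hw]; ring
      _ ≤ a * ρ a + b * ρ b := by
        gcongr
        · exact hanti _ _ ha (by linarith)
        · exact hanti _ _ hb (by linarith)
  obtain ⟨M, hM⟩ := hb
  have hbdd : ∀ x : X, BddBelow (range fun y : s => f y + c * w (dist x y)) := by
    intro x
    refine ⟨M, ?_⟩
    rintro _ ⟨y, rfl⟩
    have := hM (mem_range_self y)
    have := mul_nonneg hc (hw0 (dist x y) dist_nonneg)
    simp only
    linarith
  -- McShane's infimal convolution with the modulus `c * w`; subadditivity of `w` gives `F` this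
  -- modulus of continuity.
  set F : X → ℝ := fun x => ⨅ y : s, f y + c * w (dist x y) with hF
  have hle : ∀ x y : X, F x - F y ≤ c * w (dist x y) := by
    intro x y
    rw [sub_le_comm]
    refine le_ciInf fun z => ?_
    have h1 : F x ≤ f z + c * w (dist x z) := ciInf_le (hbdd x) z
    have h2 : w (dist x z) ≤ w (dist x y) + w (dist y z) :=
      (hmono _ _ dist_nonneg (dist_triangle x y z)).trans (hsub _ _ dist_nonneg dist_nonneg)
    nlinarith
  have habs : ∀ x y : X, |F x - F y| ≤ c * w (dist x y) := fun x y => by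
    rw [abs_le]
    have := hle y x
    rw [dist_comm] at this
    constructor <;> linarith [hle x y]
  refine ⟨F, fun x y => (habs x y).trans ?_, fun x y => (habs x y).trans ?_, fun x => ?_⟩
  · rw [hw' _ dist_nonneg]
    gcongr
    exact min_le_left _ _
  · rw [hw' _ dist_nonneg, mul_assoc, mul_comm (τ ^ _)]
    gcongr
    exact min_le_right _ _
  · have h1 : F x ≤ f x := by
      have := ciInf_le (hbdd x) x
      simpa [hw, hF] using this
    have h2 : f x - c * τ ^ α ≤ F x := by
      refine le_ciInf fun y => ?_
      have h3 := (abs_le.1 (hf x y)).2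
      have h4 : dist (x : X) y ^ α ≤ w (dist (x : X) y) + τ ^ α := by
        obtain h | h := le_total (dist (x : X) y) τ
        · have := hw0 (dist (x : X) y) dist_nonneg
          have : dist (x : X) y ^ α ≤ τ ^ α := by gcongr
          linarith
        · have : ρ (dist (x : X) y) = dist (x : X) y ^ (α - 1) :=
            min_eq_left (Real.rpow_le_rpow_of_nonpos hτ h (by linarith))
          have : w (dist (x : X) y) = dist (x : X) y ^ α := by
            simp only [hw, this]
            exact hdpow _ dist_nonneg
          have := Real.rpow_nonneg hτ.le α
          linarith
      have h5 := mul_le_mul_of_nonneg_left h4 hc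
      rw [Subtype.dist_eq] at h3
      linarith
    have : 0 ≤ c * τ ^ α := by positivity
    rw [abs_le]
    constructor <;> linarith

/-! ### Density of functions with small cell moments -/

open Filter Topology

/-- Every function of the class is approximated by functions of the class whose level sets meet few
cells. -/
lemma exists_approx_cellMomentLE {α t : ℝ} (hα₀ : 0 < α) (hα₁ : α < 1) (ht : 0 < t) (ht1 : t ≤ 1)
    {f : sierpinskiTriangle → ℝ} (hf : ∀ x y, |f x - f y| ≤ dist x y ^ α) {ε : ℝ} (hε : 0 < ε) :
    ∃ (N : ℕ) (B : ℝ), ∀ m, ∃ g : EuclideanSpace ℝ (Fin 2) → ℝ,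
      (∀ x ∈ sierpinskiTriangle, ∀ y ∈ sierpinskiTriangle, |g x - g y| ≤ dist x y ^ α) ∧
      (∀ x : sierpinskiTriangle, |g x - f x| ≤ ε) ∧
      CellMomentLE t (m + 1 + N) g (3 ^ (N + 1) * (ENNReal.ofReal B *
        (2 ^ t * ENNReal.ofReal (1 - 2 ^ (-α)) + ENNReal.ofReal (2 ^ (-α))) ^ m)) := by
  have hne : sierpinskiTriangle.Nonempty := ⟨_, sierpinskiVertex_mem 0⟩
  set v : sierpinskiTriangle := ⟨_, sierpinskiVertex_mem 0⟩ with hv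
  set M : ℝ := |f v| + 2 ^ α with hMdef
  have hM0 : 0 < M := by positivity
  have hM : ∀ x, |f x| ≤ M := by
    intro x
    have h1 := hf x v
    have h2 : dist x v ^ α ≤ 2 ^ α := by
      gcongr
      exact dist_le_two x.2 v.2
    have h3 := abs_sub_abs_le_abs_sub (f x) (f v)
    linarith
  -- Shrinking by `1 - η` leaves room in the Hölder constant for the interpolation error. Shrinking,
  -- regularization and interpolation each use `ε / 3`.
  obtain ⟨η, hη0, hη1, hηM⟩ : ∃ η : ℝ, 0 < η ∧ η < 1 ∧ η * M ≤ ε / 3 := by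
    refine ⟨min (1 / 2) (ε / 3 / M), by positivity, (min_le_left _ _).trans_lt (by norm_num), ?_⟩
    rw [← le_div_iff₀ hM0]
    exact min_le_right _ _
  set τ : ℝ := (ε / 3) ^ α⁻¹ with hτ
  have hτ0 : 0 < τ := by positivity
  have hτα : τ ^ α = ε / 3 := Real.rpow_inv_rpow (by positivity) hα₀.ne'
  obtain ⟨F, hF1, hF2, hF3⟩ := exists_lipschitz_holder_approx hne hα₀ hα₁
    (c := 1 - η) (by linarith) hτ0 (f := fun x => (1 - η) * f x)
    ⟨-M, by
      rintro _ ⟨x, rfl⟩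
      have := abs_le.1 (hM x)
      simp only
      nlinarith⟩
    (fun x y => by
      rw [← mul_sub, abs_mul, abs_of_pos (by linarith)]
      gcongr
      exact hf x y)
  set L : ℝ := (1 - η) * τ ^ (α - 1) with hL
  have hL0 : 0 < L := mul_pos (by linarith) (by positivity)
  have hFf : ∀ x : sierpinskiTriangle, |F x - f x| ≤ 2 * (ε / 3) := by
    intro x
    have h1 := hF3 x
    have h2 : |(1 - η) * f x - f x| ≤ ε / 3 := by
      rw [show (1 - η) * f x - f x = -(η * f x) by ring, abs_neg, abs_mul, abs_of_pos hη0]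
      exact (mul_le_mul_of_nonneg_left (hM x) hη0.le).trans hηM
    have h3 : (1 - η) * τ ^ α ≤ ε / 3 := by
      rw [hτα]
      nlinarith
    have := abs_sub_le (F x) ((1 - η) * f x) (f x)
    linarith
  have hlim1 : Tendsto (fun N : ℕ => ((1 / 2 : ℝ)) ^ N) atTop (𝓝 0) :=
    tendsto_pow_atTop_nhds_zero_of_lt_one (by norm_num) (by norm_num)
  have hlim2 : Tendsto (fun N : ℕ => ((2 : ℝ) ^ (α - 1)) ^ N) atTop (𝓝 0) :=
    tendsto_pow_atTop_nhds_zero_of_lt_one (by positivity)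
      (Real.rpow_lt_one_of_one_lt_of_neg (by norm_num) (by linarith))
  -- With `B = 2 * L * (1 / 2) ^ N`, the three conditions say `3 * B < ε / 3`, `2 * B * (16 * 2 ^ N)
  -- ^ α < 1` and `6 * B * (8 * 2 ^ N) ^ α < η`. The last two hold for large `N` because `α < 1`: on
  -- small cells a Lipschitz function oscillates far less than Hölder continuity allows.
  have e1 : ∀ᶠ N : ℕ in atTop, 6 * L * (1 / 2 : ℝ) ^ N < ε / 3 := by
    have := hlim1.const_mul (6 * L)
    rw [mul_zero] at this
    exact this.eventually_lt_const (by positivity)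
  have e2 : ∀ᶠ N : ℕ in atTop, 4 * L * 16 ^ α * ((2 : ℝ) ^ (α - 1)) ^ N < 1 := by
    have := hlim2.const_mul (4 * L * 16 ^ α)
    rw [mul_zero] at this
    exact this.eventually_lt_const one_pos
  have e3 : ∀ᶠ N : ℕ in atTop, 12 * L * 8 ^ α * ((2 : ℝ) ^ (α - 1)) ^ N < η := by
    have := hlim2.const_mul (12 * L * 8 ^ α)
    rw [mul_zero] at this
    exact this.eventually_lt_const hη0
  obtain ⟨N, h1, h2, h3⟩ := (e1.and (e2.and e3)).exists
  have hpow : ((2 : ℝ) ^ (α - 1)) ^ N = (2 ^ N) ^ α * (1 / 2) ^ N := by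
    rw [Real.rpow_sub_one two_ne_zero, div_pow, ← Real.rpow_natCast, ← Real.rpow_mul two_pos.le,
      mul_comm, Real.rpow_mul two_pos.le, Real.rpow_natCast, one_div, inv_pow, div_eq_mul_inv]
  set B : ℝ := 2 * L * (1 / 2) ^ N with hB
  have hB0 : 0 < B := by positivity
  refine ⟨N, B, fun m => ?_⟩
  have hq : (1 / 2 : ℝ) ≤ 2 ^ (-α) := by
    rw [one_div, ← Real.rpow_neg_one]
    exact Real.rpow_le_rpow_of_exponent_le one_le_two (by linarith)
  have hq1 : (2 : ℝ) ^ (-α) ≤ 1 := Real.rpow_le_one_of_one_le_of_nonpos one_le_two (by linarith)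
  obtain ⟨g, -, hgF, hosc, hmom⟩ := exists_interpolation (p := 1 - 2 ^ (-α)) (q := 2 ^ (-α))
    (by linarith) (by linarith) (by ring) ht ht1 m N (B := B) (f := F) (by
      intro w hw x hx y hy
      refine (hF2 _ _).trans ?_
      rw [dist_wordMap, hw]
      calc L * (dist x y / 2 ^ N) ≤ L * (2 / 2 ^ N) := by
            gcongr L * (?_ / _)
            exact dist_le_two hx hy
        _ = B := by rw [hB, one_div, inv_pow]; ring)
  refine ⟨g, fun x hx y hy => ?_, fun x => ?_, hmom⟩
  -- At small distances the oscillation bounds of the interpolant give the Hölder estimate; at large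
  -- ones `g` inherits it from `F`, with the error `6 * B` absorbed by the spare `η * dist x y ^ α`.
  · obtain hd | hd := le_total (4 * 2 ^ (N + 1) * dist x y) 1
    · refine (abs_sub_le_of_oscillation_le hα₀ (A := B) (n₀ := N + 1)
        (fun n w hw => hosc n w (by omega)) hx hy hd).trans ?_
      rw [show (8 * 2 ^ (N + 1) * dist x y : ℝ) = 16 * 2 ^ N * dist x y by ring,
        Real.mul_rpow (by positivity) dist_nonneg, Real.mul_rpow (by norm_num) (by positivity),
        ← mul_assoc]
      refine mul_le_of_le_one_left (by positivity) ?_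
      rw [hpow] at h2
      rw [hB]
      linarith
    · have k1 := abs_le.1 (hgF x hx)
      have k2 := abs_le.1 (hgF y hy)
      have k3 := abs_le.1 (hF1 x y)
      have k4 : 6 * B ≤ η * dist x y ^ α := by
        have : 1 ≤ (8 : ℝ) ^ α * (2 ^ N) ^ α * dist x y ^ α := by
          rw [← Real.mul_rpow (by norm_num) (by positivity),
            ← Real.mul_rpow (by positivity) dist_nonneg]
          refine Real.one_le_rpow ?_ hα₀.le
          rw [pow_succ] at hd
          linarith
        rw [hpow] at h3
        calc 6 * B ≤ 6 * B * ((8 : ℝ) ^ α * (2 ^ N) ^ α * dist x y ^ α) :=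
              le_mul_of_one_le_right (by positivity) this
          _ = 12 * L * 8 ^ α * ((2 ^ N) ^ α * (1 / 2) ^ N) * dist x y ^ α := by rw [hB]; ring
          _ ≤ _ := by gcongr
      rw [abs_le]
      constructor <;> linarith
  · have k1 := hgF x x.2
    have k2 := hFf x
    have := abs_sub_le (g x) (F x) (f x)
    linarith

/-! ### From moments to cell counts of typical levels -/

/-- Both sides equal `1` at `t = 0`, with derivatives `p * log 2` and `s * log 2`, so the right side
is larger for small positive `t`. -/
lemma exists_moment_exponent {p q s : ℝ} (hadd : p + q = 1) (hs : p < s) :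
    ∃ t : ℝ, 0 < t ∧ t ≤ 1 ∧ 2 ^ t * p + q < 2 ^ (s * t) := by
  have hd : HasDerivAt (fun t : ℝ => (2 : ℝ) ^ (s * t) - (2 ^ t * p + q))
      ((s - p) * Real.log 2) 0 := by
    have h1 : HasDerivAt (fun t : ℝ => (2 : ℝ) ^ t) (Real.log 2) 0 := by
      simpa using (Real.hasStrictDerivAt_const_rpow two_pos (0 : ℝ)).hasDerivAt
    have h2 : HasDerivAt (fun t : ℝ => (2 : ℝ) ^ (s * t)) (Real.log 2 * s) 0 := by
      have h3 : HasDerivAt (fun t : ℝ => s * t) s 0 := by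
        simpa using (hasDerivAt_id (0 : ℝ)).const_mul s
      have h4 : HasDerivAt (fun t : ℝ => (2 : ℝ) ^ t) (Real.log 2) (s * 0) := by simpa using h1
      exact h4.comp (0 : ℝ) h3
    exact (h2.fun_sub ((h1.mul_const p).add_const q)).congr_deriv (by ring)
  have hpos : 0 < (s - p) * Real.log 2 := mul_pos (by linarith) (Real.log_pos one_lt_two)
  have hslope := (hasDerivAt_iff_tendsto_slope_zero.1 hd).mono_left
    (nhdsWithin_mono (s := Ioi 0) 0 fun t ht => ne_of_gt (mem_Ioi.1 ht))
  have hev : ∀ᶠ t : ℝ in 𝓝[>] 0, t ≤ 1 :=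
    eventually_nhdsWithin_of_eventually_nhds (eventually_le_nhds one_pos)
  obtain ⟨t, ⟨ht, ht1⟩, ht0⟩ :=
    ((hslope.eventually_const_lt hpos).and hev).and self_mem_nhdsWithin |>.exists
  refine ⟨t, ht0, ht1, ?_⟩
  have := (pos_iff_pos_of_mul_pos ht).1 (inv_pos.2 ht0)
  simp only [zero_add, mul_zero, Real.rpow_zero] at this
  linarith

/-- Approximation by functions for which the typical level set meets few cells of a high level. -/
lemma exists_approx_cellCount {α s : ℝ} (hα₀ : 0 < α) (hα₁ : α < 1) (hs : 1 - 2 ^ (-α) < s)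
    {f : sierpinskiTriangle → ℝ} (hf : ∀ x y, |f x - f y| ≤ dist x y ^ α) {ε : ℝ} (hε : 0 < ε)
    (k : ℕ) {η : ℝ} (hη : 0 < η) :
    ∃ g : EuclideanSpace ℝ (Fin 2) → ℝ,
      (∀ x ∈ sierpinskiTriangle, ∀ y ∈ sierpinskiTriangle, |g x - g y| ≤ dist x y ^ α) ∧
      (∀ x : sierpinskiTriangle, |g x - f x| ≤ ε) ∧
      ∃ n ≥ k, ∃ δ > 0, volume {r | ENNReal.ofReal (η * (2 ^ n) ^ s) ≤ cellCount n g δ r} ≤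
        ENNReal.ofReal η := by
  have hq1 : (2 : ℝ) ^ (-α) ≤ 1 := Real.rpow_le_one_of_one_le_of_nonpos one_le_two (by linarith)
  obtain ⟨t, ht0, ht1, ht⟩ := exists_moment_exponent (p := 1 - 2 ^ (-α)) (q := 2 ^ (-α))
    (by ring) hs
  obtain ⟨N, B, H⟩ := exists_approx_cellMomentLE hα₀ hα₁ ht0 ht1 hf hε
  set κ : ℝ := 2 ^ t * (1 - 2 ^ (-α)) + 2 ^ (-α) with hκ
  have hp0 : 0 ≤ 1 - (2 : ℝ) ^ (-α) := by linarith
  have hκ0 : 0 ≤ κ := by positivity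
  have hκE : 2 ^ t * ENNReal.ofReal (1 - 2 ^ (-α)) + ENNReal.ofReal (2 ^ (-α)) =
      ENNReal.ofReal κ := by
    have h2 : (2 : ℝ≥0∞) ^ t = ENNReal.ofReal (2 ^ t) := by
      rw [← ENNReal.ofReal_rpow_of_pos two_pos]; simp
    rw [hκ, ENNReal.ofReal_add (by positivity) (by positivity), ENNReal.ofReal_mul (by positivity),
      h2]
  set B' : ℝ := max B 0 with hB'
  have hB0 : 0 ≤ B' := le_max_right _ _
  -- `D` is the part of the Markov threshold `η * K ^ t` that does not depend on `m`. As `N` and `B`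
  -- are fixed before `m`, the geometric decay in `m` beats the constant `3 ^ (N + 1) * B'`.
  set D : ℝ := η * (η ^ t * ((2 : ℝ) ^ (1 + N)) ^ (s * t)) with hD
  have hD0 : 0 < D := by positivity
  have hlim : Tendsto (fun m : ℕ => 3 ^ (N + 1) * B' * (κ / 2 ^ (s * t)) ^ m) atTop (𝓝 0) := by
    simpa using (tendsto_pow_atTop_nhds_zero_of_lt_one (by positivity)
      ((div_lt_one (by positivity)).2 ht)).const_mul (3 ^ (N + 1) * B')
  obtain ⟨m, hm, hkm⟩ := ((hlim.eventually_lt_const hD0).and (eventually_ge_atTop k)).exists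
  obtain ⟨g, hg1, hg2, C, hC, hmom⟩ := H m
  refine ⟨g, hg1, hg2, m + 1 + N, by omega, ?_⟩
  set n := m + 1 + N with hn
  set K : ℝ := η * (2 ^ n) ^ s with hK
  have hK0 : 0 < K := by positivity
  have hKt : η * K ^ t = D * (2 ^ (s * t)) ^ m := by
    rw [hK, hD, Real.mul_rpow hη.le (by positivity), ← Real.rpow_mul (by positivity), hn,
      show m + 1 + N = m + (1 + N) by ring, pow_add, Real.mul_rpow (by positivity) (by positivity),
      ← Real.rpow_natCast (2 ^ (s * t)), ← Real.rpow_natCast 2 m, ← Real.rpow_mul two_pos.le,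
      ← Real.rpow_mul two_pos.le, mul_comm (m : ℝ)]
    ring
  have hmain : 3 ^ (N + 1) * B' * κ ^ m < η * K ^ t := by
    rw [hKt, ← div_lt_iff₀ (by positivity), mul_div_assoc, ← div_pow]
    exact hm
  -- The error constant `C` may depend on `m`, so `δ` is chosen last, small enough that `C * δ` fits
  -- into the slack; the `+ 1` covers `C = 0`.
  set δ : ℝ := (η * K ^ t - 3 ^ (N + 1) * B' * κ ^ m) / (C.toReal + 1) with hδ
  have hδ0 : 0 < δ := div_pos (by linarith) (by positivity)
  refine ⟨δ, hδ0, ?_⟩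
  have hint : ∫⁻ r, cellCount n g δ r ^ t ≤ ENNReal.ofReal (K ^ t) * ENNReal.ofReal η := by
    refine (hmom δ hδ0).trans ?_
    have hBE : ENNReal.ofReal B = ENNReal.ofReal B' := by
      simp [hB', ENNReal.ofReal_max]
    have h3 : (3 : ℝ≥0∞) ^ (N + 1) = ENNReal.ofReal (3 ^ (N + 1)) := by
      rw [ENNReal.ofReal_pow (by norm_num)]; simp
    rw [hκE, hBE, ← ENNReal.ofReal_pow hκ0, ← ENNReal.ofReal_mul hB0, h3,
      ← ENNReal.ofReal_mul (by positivity), ← ENNReal.ofReal_toReal hC,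
      ← ENNReal.ofReal_mul ENNReal.toReal_nonneg, ← ENNReal.ofReal_add (by positivity)
      (by positivity), ← ENNReal.ofReal_mul (by positivity)]
    refine ENNReal.ofReal_le_ofReal ?_
    have : C.toReal * δ ≤ η * K ^ t - 3 ^ (N + 1) * B' * κ ^ m := by
      rw [hδ, ← mul_div_assoc, div_le_iff₀ (by positivity), mul_comm]
      gcongr
      · linarith
    linarith
  have hmarkov := mul_meas_ge_le_lintegral (μ := volume)
    ((measurable_cellCount n g δ).pow_const t) (ENNReal.ofReal (K ^ t))
  have hset : {r | ENNReal.ofReal (K ^ t) ≤ cellCount n g δ r ^ t} =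
      {r | ENNReal.ofReal K ≤ cellCount n g δ r} := by
    ext r
    simp only [mem_ofPred_eq]
    rw [← ENNReal.ofReal_rpow_of_pos hK0, ENNReal.rpow_le_rpow_iff ht0]
  rw [hset] at hmarkov
  refine (ENNReal.mul_le_mul_iff_right ?_ ENNReal.ofReal_ne_top).1 (hmarkov.trans hint)
  rw [Ne, ENNReal.ofReal_eq_zero, not_le]
  positivity

/-! ### Hausdorff dimension from covers -/

/-- A set that is covered by few cells, for a sequence of levels tending to infinity, has small
Hausdorff dimension. -/
lemma dimH_le_of_covers {X : Type*} [MetricSpace X] {S : Set X} {s : ℝ} (hs : 0 < s)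
    {n : ℕ → ℕ} (hn : Tendsto n atTop atTop) {η : ℕ → ℝ} (hη : Tendsto η atTop (𝓝 0))
    (h : ∀ᶠ k in atTop, ∃ F : Finset (Set X),
      (F.card : ℝ≥0∞) ≤ ENNReal.ofReal (η k * (2 ^ n k) ^ s) ∧
      (∀ u ∈ F, ∀ x ∈ u, ∀ y ∈ u, dist x y ≤ 2 / 2 ^ n k) ∧ S ⊆ ⋃ u ∈ F, u) :
    dimH S ≤ ENNReal.ofReal s := by
  borelize X
  classical
  obtain ⟨F, hF'⟩ := h.choice
  have hediam : ∀ᶠ k in atTop, ∀ u : F k,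
      Metric.ediam (u : Set X) ≤ ENNReal.ofReal (2 / 2 ^ n k) := by
    filter_upwards [hF'] with k hk u
    refine Metric.ediam_le fun x hx y hy => ?_
    rw [edist_dist]
    exact ENNReal.ofReal_le_ofReal (hk.2.1 u u.2 x hx y hy)
  have hr : Tendsto (fun k => ENNReal.ofReal (2 / 2 ^ n k)) atTop (𝓝 0) := by
    rw [← ENNReal.ofReal_zero]
    refine ENNReal.tendsto_ofReal ?_
    have h1 : Tendsto (fun m : ℕ => (2 : ℝ) / 2 ^ m) atTop (𝓝 0) :=
      tendsto_const_nhds.div_atTop (tendsto_pow_atTop_atTop_of_one_lt one_lt_two)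
    exact h1.comp hn
  have hmeas := Measure.hausdorffMeasure_le_liminf_sum (ι := fun k => F k) s S _ hr
    (fun k u => (u : Set X)) hediam (by
      filter_upwards [hF'] with k hk x hx
      obtain ⟨u, hu, hxu⟩ := mem_iUnion₂.1 (hk.2.2 hx)
      exact mem_iUnion.2 ⟨⟨u, hu⟩, hxu⟩)
  -- The number of sets times `(2 / 2 ^ n k) ^ s` is at most `η k * 2 ^ s`, which tends to `0`;
  -- hence the `s`-dimensional measure vanishes.
  have hle : ∀ᶠ k in atTop, ∑ u : F k, Metric.ediam (u : Set X) ^ s ≤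
      ENNReal.ofReal (η k * 2 ^ s) := by
    filter_upwards [hF', hediam] with k hk hk'
    calc ∑ u : F k, Metric.ediam (u : Set X) ^ s
        ≤ ∑ _u : F k, ENNReal.ofReal (2 / 2 ^ n k) ^ s :=
          Finset.sum_le_sum fun u _ => ENNReal.rpow_le_rpow (hk' u) hs.le
      _ = (F k).card * ENNReal.ofReal ((2 / 2 ^ n k) ^ s) := by
          rw [ENNReal.ofReal_rpow_of_pos (by positivity)]
          simp
      _ ≤ ENNReal.ofReal (η k * (2 ^ n k) ^ s) * ENNReal.ofReal ((2 / 2 ^ n k) ^ s) := by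
          gcongr
          exact hk.1
      _ = ENNReal.ofReal (η k * 2 ^ s) := by
          rw [← ENNReal.ofReal_mul' (by positivity), mul_assoc,
            ← Real.mul_rpow (by positivity) (by positivity), mul_div_cancel₀ _ (by positivity)]
  have hlim : Tendsto (fun k => ENNReal.ofReal (η k * 2 ^ s)) atTop (𝓝 0) := by
    rw [← ENNReal.ofReal_zero]
    refine ENNReal.tendsto_ofReal ?_
    simpa using hη.mul_const ((2 : ℝ) ^ s)
  have hzero : μH[s] S = 0 := by
    refine le_antisymm (hmeas.trans ?_) zero_le
    rw [← hlim.liminf_eq]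
    exact liminf_le_liminf hle
  refine dimH_le_of_hausdorffMeasure_ne_top (d := s.toNNReal) ?_
  rw [Real.coe_toNNReal s hs.le, hzero]
  exact ENNReal.zero_ne_top

/-! ### Baire category argument -/

instance {p : ℕ} (c α : ℝ) (F : Set (EuclideanSpace ℝ (Fin p))) :
    CompleteSpace (holderClass c α F) := by
  refine IsClosed.completeSpace_coe (hs := ?_)
  simp only [holderClass, ofPred_forall]
  refine isClosed_iInter fun x => isClosed_iInter fun y => isClosed_le ?_ continuous_const
  exact ((BoundedContinuousFunction.lipschitz_eval_const x).continuous.sub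
    (BoundedContinuousFunction.lipschitz_eval_const y).continuous).abs

lemma exists_mem_holderClass {α : ℝ} (hα : 0 < α) {g : EuclideanSpace ℝ (Fin 2) → ℝ}
    (hg : ∀ x ∈ sierpinskiTriangle, ∀ y ∈ sierpinskiTriangle, |g x - g y| ≤ dist x y ^ α) :
    ∃ G : holderClass 1 α sierpinskiTriangle,
      ∀ x, (G : sierpinskiTriangle →ᵇ ℝ) x = g x := by
  have hc : Continuous fun x : sierpinskiTriangle => g x := by
    refine continuous_iff_continuousAt.2 fun x => tendsto_iff_dist_tendsto_zero.2 ?_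
    have h1 : Tendsto (fun y : sierpinskiTriangle => dist y x ^ α) (𝓝 x) (𝓝 0) := by
      have : Continuous fun y : sierpinskiTriangle => dist y x ^ α :=
        (continuous_id.dist continuous_const).rpow_const fun _ => Or.inr hα.le
      simpa [hα.ne'] using this.tendsto x
    exact squeeze_zero (fun _ => dist_nonneg) (fun y => hg y y.2 x x.2) h1
  refine ⟨⟨BoundedContinuousFunction.mkOfBound ⟨_, hc⟩ (2 ^ α) fun x y => ?_, fun x y => ?_⟩,
    fun x => rfl⟩
  · refine (hg x x.2 y y.2).trans ?_
    gcongr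
    exact dist_le_two x.2 y.2
  · rw [one_mul]
    exact hg x x.2 y y.2

/-- The functions close to one whose typical level set meets few cells of some level `n ≥ k`. -/
def fewCellsNear (α s : ℝ) (k : ℕ) : Set (holderClass 1 α sierpinskiTriangle) :=
  {f | ∃ h : EuclideanSpace ℝ (Fin 2) → ℝ, ∃ n ≥ k, ∃ δ > 0,
    volume {r | ENNReal.ofReal ((1 / 2) ^ k * (2 ^ n) ^ s) ≤ cellCount n h δ r} ≤
      ENNReal.ofReal ((1 / 2) ^ k) ∧
    ∃ g : holderClass 1 α sierpinskiTriangle,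
      (∀ x, (g : sierpinskiTriangle →ᵇ ℝ) x = h x) ∧ dist f g < δ}

lemma isOpen_fewCellsNear (α s : ℝ) (k : ℕ) : IsOpen (fewCellsNear α s k) := by
  refine Metric.isOpen_iff.2 ?_
  rintro f ⟨h, n, hn, δ, hδ, hvol, g, hg, hfg⟩
  refine ⟨δ - dist f g, by linarith, fun f' hf' => ⟨h, n, hn, δ, hδ, hvol, g, hg, ?_⟩⟩
  have := dist_triangle f' f g
  rw [Metric.mem_ball] at hf'
  linarith

lemma dense_fewCellsNear {α s : ℝ} (hα₀ : 0 < α) (hα₁ : α < 1) (hs : 1 - 2 ^ (-α) < s) (k : ℕ) :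
    Dense (fewCellsNear α s k) := by
  refine Metric.dense_iff.2 fun f ε hε => ?_
  obtain ⟨h, h1, h2, n, hn, δ, hδ, hvol⟩ := exists_approx_cellCount hα₀ hα₁ hs
    (f := (f : sierpinskiTriangle →ᵇ ℝ)) (fun x y => by simpa using f.2 x y) (half_pos hε) k
    (η := (1 / 2) ^ k) (by positivity)
  obtain ⟨g, hg⟩ := exists_mem_holderClass hα₀ h1
  refine ⟨g, ?_, h, n, hn, δ, hδ, hvol, g, hg, by simpa using hδ⟩
  rw [Metric.mem_ball, Subtype.dist_eq]
  refine ((BoundedContinuousFunction.dist_le (half_pos hε).le).2 fun x => ?_).trans_lt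
    (half_lt_self hε)
  rw [hg, Real.dist_eq]
  exact h2 x

/-- The exceptional sets of levels have measures at most `(1 / 2) ^ k`, which are summable. By
Borel–Cantelli almost every `r` avoids them for all large `k`, and the counted cells then cover the
level set of `f`. -/
lemma essLevelDim_le_of_mem_fewCellsNear {α s : ℝ} (hs : 0 < s)
    {f : holderClass 1 α sierpinskiTriangle} (hf : ∀ k, f ∈ fewCellsNear α s k) :
    essLevelDim (f : sierpinskiTriangle →ᵇ ℝ) ≤ ENNReal.ofReal s := by
  classical
  choose h n hn δ hδ hvol g hg hfg using hf
  set f' : EuclideanSpace ℝ (Fin 2) → ℝ := fun x =>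
    if hx : x ∈ sierpinskiTriangle then (f : sierpinskiTriangle →ᵇ ℝ) ⟨x, hx⟩ else 0 with hf'
  have hclose : ∀ k, ∀ x ∈ sierpinskiTriangle, |f' x - h k x| < δ k := by
    intro k x hx
    have h1 := (BoundedContinuousFunction.dist_coe_le_dist (f := (f : sierpinskiTriangle →ᵇ ℝ))
      (g := g k) ⟨x, hx⟩).trans_lt (hfg k)
    rw [hg, Real.dist_eq] at h1
    simpa [hf', hx] using h1
  have hsum : ∑' k, volume {r | ENNReal.ofReal ((1 / 2) ^ k * (2 ^ n k) ^ s) ≤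
      cellCount (n k) (h k) (δ k) r} ≠ ∞ := by
    refine ne_top_of_le_ne_top ?_ (ENNReal.tsum_le_tsum hvol)
    rw [← ENNReal.ofReal_tsum_of_nonneg (fun k => by positivity) summable_geometric_two]
    exact ENNReal.ofReal_ne_top
  have hae : ∀ᵐ r, levelDim (f : sierpinskiTriangle →ᵇ ℝ) r ≤ ENNReal.ofReal s := by
    filter_upwards [ae_eventually_notMem hsum] with r hr
    refine dimH_le_of_covers hs (tendsto_atTop_mono hn tendsto_id)
      (tendsto_pow_atTop_nhds_zero_of_lt_one (r := (1 / 2 : ℝ)) (by norm_num) (by norm_num)) ?_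
    filter_upwards [hr] with k hk
    obtain ⟨F, hF1, hF2, hF3⟩ := exists_cover_level (n k) (hclose k) r
    refine ⟨F, hF1.trans (not_le.1 hk).le, hF2, Subset.trans ?_ hF3⟩
    rintro _ ⟨x, hx, rfl⟩
    refine ⟨x.2, ?_⟩
    simpa [hf'] using hx
  refine sSup_le fun d hd => ?_
  by_contra! hlt
  refine (ne_of_gt hd) (measure_mono_null (fun r hr => ?_) hae)
  exact not_le.2 (hlt.trans_le hr)

theorem theorem4p5 (α : ℝ) (hα₀ : 0 < α) (hα₁ : α < 1) :
    genericLevelDim α sierpinskiTriangle ≤ ENNReal.ofReal (1 - (2 : ℝ) ^ (-α)) := by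
  have hq1 : (2 : ℝ) ^ (-α) ≤ 1 := Real.rpow_le_one_of_one_le_of_nonpos one_le_two (by linarith)
  refine ENNReal.le_of_forall_pos_le_add fun ε hε _ => iSup₂_le fun G hG => ?_
  set s : ℝ := 1 - 2 ^ (-α) + ε with hs
  have hs1 : 1 - 2 ^ (-α) < s := by simpa [hs] using hε
  have hR : Dense (⋂ k, fewCellsNear α s k) :=
    dense_iInter_of_isOpen (fun k => isOpen_fewCellsNear α s k)
      fun k => dense_fewCellsNear hα₀ hα₁ hs1 k
  have hRG : IsGδ (⋂ k, fewCellsNear α s k) :=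
    .iInter_of_isOpen fun k => isOpen_fewCellsNear α s k
  obtain ⟨g₀, -⟩ := exists_mem_holderClass hα₀ (g := fun _ => 0) fun x _ y _ => by
    simpa using Real.rpow_nonneg dist_nonneg α
  have : Nonempty (holderClass 1 α sierpinskiTriangle) := ⟨g₀⟩
  -- Bounding the infimum over an arbitrary `G` takes only one good function in it, and two dense
  -- `G_δ` sets of a nonempty complete space intersect.
  obtain ⟨f, hfG, hfR⟩ := (hG.2.inter_of_Gδ hG.1 hRG hR).nonempty
  refine (iInf₂_le f hfG).trans ?_
  refine (essLevelDim_le_of_mem_fewCellsNear (by linarith) (mem_iInter.1 hfR)).trans_eq ?_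
  rw [hs, ENNReal.ofReal_add (by linarith) ε.coe_nonneg, ENNReal.ofReal_coe_nnreal]
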